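/- Let $n,k,i$ be integers with $n\ge 2k>0$ and $3\le i\le k+1$. Write $[n]=\{1,\dots,n\}$ and let $\binom{[n]}{k}$ be the family of all $k$-element subsets of $[n]$. Families $\mathcal A,\mathcal B\subset\binom{[n]}{k}$ are called cross-intersecting if $A\cap B\neq\emptyset$ for all $A\in\mathcal A$, $B\in\mathcal B$. (1) If $\mathcal A,\mathcal B\subset\binom{[n]}{k}$ are cross-intersecting and $|\mathcal B|\ge\binom{n-1}{k-1}+\binom{n-i}{k-i+1}$, then $$|\mathcal A||\mathcal B|\le\Bigl(\binom{n-1}{k-1}+\binom{n-i}{k-i+1}\Bigr)\Bigl(\binom{n-1}{k-1}-\binom{n-i}{k-1}\Bigr).$$ (2) The bound is attained: the families $\mathcal A_i=\{A\in\binom{[n]}{k}: 1\in A,\ [2,i]\cap A\ne\emptyset\}$ and $\mathcal B_i=\{B\in\binom{[n]}{k}: 1\in B\}\cup\{B\in\binom{[n]}{k}: 1\notin B,\ [2,i]\subset B\}$, where $[2,i]=\{2,\dots,i\}$, are cross-intersecting with $|\mathcal A_i|=\binom{n-1}{k-1}-\binom{n-i}{k-1}$ and $|\mathcal B_i|=\binom{n-1}{k-1}+\binom{n-i}{k-i+1}$,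 so that equality holds in (1) for this pair. -/

import Mathlib

namespace CrossInt

/-- `[n] choose k`: the family of all `k`-element subsets of `[n] = {1, …, n}`. -/
def kSubsets (n k : ℕ) : Finset (Finset ℕ) :=
  Finset.powersetCard k (Finset.Icc 1 n)

/-- Two families are cross-intersecting if every member of the first meets every member of
the second. -/
def CrossIntersecting (𝒜 ℬ : Finset (Finset ℕ)) : Prop :=
  ∀ A ∈ 𝒜, ∀ B ∈ ℬ, A ∩ B ≠ ∅

/-- `𝒜ᵢ`: the `k`-subsets of `[n]` that contain `1` and meet `[2, i]`. -/
def exampleA (n k i : ℕ) : Finset (Finset ℕ) :=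
  {A ∈ kSubsets n k | 1 ∈ A ∧ Finset.Icc 2 i ∩ A ≠ ∅}

/-- `ℬᵢ`: the `k`-subsets of `[n]` that contain `1`, together with those that do not contain `1`
but contain all of `[2, i]`. -/
def exampleB (n k i : ℕ) : Finset (Finset ℕ) :=
  {B ∈ kSubsets n k | 1 ∈ B} ∪ {B ∈ kSubsets n k | 1 ∉ B ∧ Finset.Icc 2 i ⊆ B}

end CrossInt

/-!
By the Kruskal–Katona theorem the complements of `ℬ` may be taken to form a colex initial segment.
Then `ℬ` either lies in the star of the last point or contains it, and in the latter case every
member of `𝒜` passes through that point. So the last point can be removed, at the cost of lowering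
one uniformity and subtracting the size of a star from one of the two cardinalities.

After enough such steps the double counting of disjoint pairs confines the two remaining sizes to
the region below a segment. The slope of this segment makes the product of the original sizes
largest at the endpoint that corresponds to the extremal pair `(𝒜ᵢ, ℬᵢ)`.
-/

open Finset
open scoped FinsetFamily

namespace CrossInt

section Segment

/-- The point `(u, M + v)` lies below the segment from `(c + y, M)` to `(c, M + x)`. -/
lemma mul_add_le_of_below_segment {x y c M u v : ℕ} (hx : 0 < x) (hslope : x * (c + y) ≤ y * M)
    (hline : (u - c) * x + v * y ≤ y * x) : u * (M + v) ≤ (c + y) * M := by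
  have hy : u - c ≤ y := Nat.le_of_mul_le_mul_right ((Nat.le_add_right _ _).trans hline) hx
  obtain ⟨w, hw⟩ := Nat.exists_eq_add_of_le hy
  have hvw : v * y ≤ w * x := by
    rw [hw, add_mul] at hline
    rw [hw]
    omega
  have hv : v * (c + y) ≤ w * M := by
    refine Nat.le_of_mul_le_mul_right ?_ hx
    calc v * (c + y) * x = v * (x * (c + y)) := by ring
      _ ≤ v * (y * M) := by gcongr
      _ = v * y * M := by ring
      _ ≤ w * x * M := by gcongr
      _ = w * M * x := by ring
  calc u * (M + v) ≤ (c + (u - c)) * (M + v) := by gcongr; omega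
    _ ≤ (c + (u - c)) * M + v * (c + y) := by rw [mul_add, mul_comm v]; gcongr
    _ ≤ (c + (u - c)) * M + w * M := by gcongr
    _ = (c + y) * M := by rw [← add_mul, add_assoc, ← hw]

end Segment

section Choose

lemma choose_mul_choose_sub_comm {m a b : ℕ} :
    m.choose a * (m - a).choose b = m.choose b * (m - b).choose a := by
  have ha := Nat.choose_mul (n := m) (k := a + b) (s := a) (Nat.le_add_right a b)
  have hb := Nat.choose_mul (n := m) (k := a + b) (s := b) (Nat.le_add_left b a)
  rw [Nat.add_sub_cancel_left] at ha
  rw [Nat.add_sub_cancel] at hb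
  rw [← ha, ← hb, Nat.choose_symm_add]

lemma choose_le_choose_of_le_half {l p q : ℕ} (hpq : p ≤ q) (hq : q ≤ l / 2) :
    l.choose p ≤ l.choose q := by
  induction q, hpq using Nat.le_induction with
  | base => exact le_rfl
  | succ q _ ih => exact (ih (by omega)).trans (Nat.choose_le_succ_of_lt_half_left (by omega))

lemma choose_le_choose_of_add_le {l p q : ℕ} (hpq : p ≤ q) (hl : p + q ≤ l) :
    l.choose p ≤ l.choose q := by
  rcases le_or_gt q (l / 2) with hq | hq
  · exact choose_le_choose_of_le_half hpq hq
  · rw [← Nat.choose_symm (show q ≤ l by omega)]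
    exact choose_le_choose_of_le_half (by omega) (by omega)

lemma choose_le_choose_add_add (l b s : ℕ) : l.choose b ≤ (l + s).choose (b + s) := by
  induction s with
  | zero => exact le_rfl
  | succ s ih => exact ih.trans (Nat.choose_succ_succ' (l + s) (b + s) ▸ Nat.le_add_right _ _)

lemma choose_mul_choose_add_two_le_sq (l b : ℕ) :
    l.choose b * l.choose (b + 2) ≤ l.choose (b + 1) ^ 2 := by
  have h₁ := Nat.choose_succ_right_eq l b
  have h₂ := Nat.choose_succ_right_eq l (b + 1)
  refine Nat.le_of_mul_le_mul_right ?_ (Nat.succ_pos (b + 1))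
  calc l.choose b * l.choose (b + 2) * (b + 1 + 1)
      = l.choose b * (l - (b + 1)) * l.choose (b + 1) := by rw [mul_assoc, h₂]; ring
    _ ≤ l.choose b * (l - b) * l.choose (b + 1) := by gcongr; omega
    _ = l.choose (b + 1) ^ 2 * (b + 1) := by rw [← h₁]; ring
    _ ≤ l.choose (b + 1) ^ 2 * (b + 1 + 1) := by gcongr; omega

lemma choose_mul_succ_choose_le {l a b : ℕ} (hab : a ≤ b) :
    l.choose b * (l + 1).choose a ≤ l.choose a * (l + 1).choose b := by
  have ha := Nat.choose_mul_succ_eq l a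
  have hb := Nat.choose_mul_succ_eq l b
  refine Nat.le_of_mul_le_mul_right ?_ (Nat.succ_pos l)
  calc l.choose b * (l + 1).choose a * (l + 1)
      = (l + 1).choose b * (l + 1 - b) * (l + 1).choose a := by rw [← hb]; ring
    _ ≤ (l + 1).choose b * (l + 1 - a) * (l + 1).choose a := by gcongr
    _ = l.choose a * (l + 1).choose b * (l + 1) := by rw [mul_right_comm _ _ (l + 1), ha]; ring

lemma choose_mul_succ_choose_succ_le {l n : ℕ} (hln : l ≤ n) (b : ℕ) :
    n.choose b * (l + 1).choose (b + 1) ≤ l.choose b * (n + 1).choose (b + 1) := by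
  have hl := Nat.add_one_mul_choose_eq l b
  have hn := Nat.add_one_mul_choose_eq n b
  refine Nat.le_of_mul_le_mul_right ?_ (Nat.succ_pos b)
  calc n.choose b * (l + 1).choose (b + 1) * (b + 1)
      = (l + 1) * (n.choose b * l.choose b) := by rw [mul_assoc, ← hl]; ring
    _ ≤ (n + 1) * (n.choose b * l.choose b) := by gcongr
    _ = l.choose b * (n + 1).choose (b + 1) * (b + 1) := by rw [mul_assoc _ _ (b + 1), ← hn]; ring

lemma choose_add_choose_mul_choose_le (l b : ℕ) :
    ((l + 2).choose (b + 1) + l.choose b) * (l + 1).choose (b + 2) ≤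
      l.choose (b + 1) * ((l + 3).choose (b + 2) + (l + 1).choose (b + 1)) := by
  have hsmall : l.choose b * (l + 1).choose (b + 2) ≤
      l.choose (b + 1) * (l + 1).choose (b + 1) := by
    have := choose_mul_choose_add_two_le_sq l b
    rw [Nat.choose_succ_succ' l (b + 1), Nat.choose_succ_succ' l b]
    linarith
  rw [add_mul, mul_add]
  exact add_le_add (choose_mul_succ_choose_succ_le (Nat.le_add_right l 2) (b + 1)) hsmall

lemma choose_mul_choose_sub_le {l b s : ℕ} (hl : 2 * b + s + 1 ≤ l) :
    l.choose (b + 1) * ((l + s + 2).choose (b + s + 1) - (l + 1).choose (b + s + 1)) ≤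
      l.choose (b + s) * ((l + s + 2).choose (b + s + 1) + l.choose b) := by
  cases s with
  | zero =>
    have hpascal : (l + 2).choose (b + 1) = (l + 1).choose b + (l + 1).choose (b + 1) :=
      Nat.choose_succ_succ' (l + 1) b
    calc l.choose (b + 1) * ((l + 2).choose (b + 1) - (l + 1).choose (b + 1))
        = l.choose (b + 1) * (l + 1).choose b := by congr 1; omega
      _ ≤ l.choose b * (l + 1).choose (b + 1) := choose_mul_succ_choose_le (Nat.le_succ b)
      _ ≤ l.choose b * ((l + 2).choose (b + 1) + l.choose b) := by gcongr; omega
  | succ s =>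
    refine Nat.mul_le_mul ?_ (by omega)
    exact choose_le_choose_of_add_le (by omega) (by omega)

end Choose

section Families

variable {α β : Type*}

/-- The family of those subsets of `α` that an embedding `f : α ↪ β` maps to members of a family on
`β`; it is used to change the ground set. -/
noncomputable def pullback (f : α ↪ β) (𝒜 : Finset (Finset β)) : Finset (Finset α) :=
  𝒜.preimage (Finset.map f) (map_injective f).injOn

@[simp]
lemma mem_pullback {f : α ↪ β} {𝒜 : Finset (Finset β)} {s : Finset α} :
    s ∈ pullback f 𝒜 ↔ s.map f ∈ 𝒜 :=
  mem_preimage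

lemma card_pullback {f : α ↪ β} {𝒜 : Finset (Finset β)}
    (h : ∀ A ∈ 𝒜, (A : Set β) ⊆ Set.range f) : #(pullback f 𝒜) = #𝒜 := by
  refine card_bij (fun s _ ↦ s.map f) (fun _ hs ↦ mem_pullback.1 hs)
    (fun _ _ _ _ hst ↦ map_injective f hst) fun A hA ↦ ?_
  obtain ⟨s, rfl⟩ : ∃ s : Finset α, s.map f = A := by
    classical
    obtain ⟨s, -, hs⟩ := subset_set_image_iff.1 ((h A hA).trans_eq Set.image_univ.symm)
    exact ⟨s, by rw [map_eq_image, hs]⟩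
  exact ⟨s, mem_pullback.2 hA, rfl⟩

/-- An `a`-uniform and a `b`-uniform family, every member of the first of which meets every member
of the second. -/
structure UniformCross (a b : ℕ) (𝒜 ℬ : Finset (Finset α)) : Prop where
  sized_left : (𝒜 : Set (Finset α)).Sized a
  sized_right : (ℬ : Set (Finset α)).Sized b
  not_disjoint : ∀ A ∈ 𝒜, ∀ B ∈ ℬ, ¬ Disjoint A B

lemma UniformCross.pullback {a b : ℕ} {𝒜 ℬ : Finset (Finset β)} (h : UniformCross a b 𝒜 ℬ)
    (f : α ↪ β) : UniformCross a b (pullback f 𝒜) (pullback f ℬ) where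
  sized_left _ hs := (card_map f).symm.trans (h.sized_left (mem_pullback.1 hs))
  sized_right _ hs := (card_map f).symm.trans (h.sized_right (mem_pullback.1 hs))
  not_disjoint _ hs _ ht hst :=
    h.not_disjoint _ (mem_pullback.1 hs) _ (mem_pullback.1 ht) ((disjoint_map f).2 hst)

/-- Double counting of the disjoint pairs formed by a member of `ℬ` and an `a`-set outside `𝒜`. -/
lemma UniformCross.card_mul_choose_le [Fintype α] [DecidableEq α] {a b : ℕ}
    {𝒜 ℬ : Finset (Finset α)} (h : UniformCross a b 𝒜 ℬ) :
    #ℬ * (Fintype.card α - b).choose a ≤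
      #(powersetCard a univ \ 𝒜) * (Fintype.card α - a).choose b := by
  refine card_mul_le_card_mul (fun B A : Finset α ↦ Disjoint A B) (fun B hB ↦ ?_) fun A hA ↦ ?_
  · have hsub : powersetCard a Bᶜ ⊆
        bipartiteAbove (fun B A : Finset α ↦ Disjoint A B) (powersetCard a univ \ 𝒜) B := by
      intro A hA
      obtain ⟨hAB, hAa⟩ := mem_powersetCard.1 hA
      have hdisj : Disjoint A B := subset_compl_iff_disjoint_right.1 hAB
      simp only [mem_bipartiteAbove, mem_sdiff, mem_powersetCard_univ]
      exact ⟨⟨hAa, fun hA' ↦ h.not_disjoint A hA' B hB hdisj⟩, hdisj⟩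
    simpa only [card_powersetCard, card_compl, h.sized_right hB] using card_le_card hsub
  · have hsub : bipartiteBelow (fun B A : Finset α ↦ Disjoint A B) ℬ A ⊆ powersetCard b Aᶜ := by
      intro B hB
      obtain ⟨hB, hAB⟩ := (mem_bipartiteBelow _).1 hB
      exact mem_powersetCard.2 ⟨subset_compl_iff_disjoint_left.2 hAB, h.sized_right hB⟩
    have hAa : #A = a := mem_powersetCard_univ.1 (mem_sdiff.1 hA).1
    simpa only [card_powersetCard, card_compl, hAa] using card_le_card hsub

lemma UniformCross.card_mul_add_card_mul_le [Fintype α] {a b : ℕ}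
    {𝒜 ℬ : Finset (Finset α)} (h : UniformCross a b 𝒜 ℬ) (hab : a + b ≤ Fintype.card α) :
    #𝒜 * (Fintype.card α).choose b + #ℬ * (Fintype.card α).choose a ≤
      (Fintype.card α).choose a * (Fintype.card α).choose b := by
  classical
  set N := Fintype.card α
  have hpos : 0 < (N - b).choose a := Nat.choose_pos (by omega)
  have hcount := h.card_mul_choose_le
  have hcompl : #𝒜 + #(powersetCard a univ \ 𝒜) = N.choose a := by
    rw [add_comm, card_sdiff_add_card_eq_card (subset_powersetCard_univ_iff.2 h.sized_left),
      card_powersetCard, card_univ]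
  have hℬ : #ℬ * N.choose a ≤ #(powersetCard a univ \ 𝒜) * N.choose b := by
    refine Nat.le_of_mul_le_mul_right ?_ hpos
    calc #ℬ * N.choose a * (N - b).choose a
        = #ℬ * (N - b).choose a * N.choose a := mul_right_comm ..
      _ ≤ #(powersetCard a univ \ 𝒜) * (N - a).choose b * N.choose a := by gcongr
      _ = #(powersetCard a univ \ 𝒜) * N.choose b * (N - b).choose a := by
          rw [mul_assoc, mul_assoc, mul_comm _ (N.choose a), choose_mul_choose_sub_comm]
  calc #𝒜 * N.choose b + #ℬ * N.choose a
      ≤ #𝒜 * N.choose b + #(powersetCard a univ \ 𝒜) * N.choose b := by gcongr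
    _ = N.choose a * N.choose b := by rw [← add_mul, hcompl]

end Families

section InitialSegments

lemma exists_isInitSeg_card {α : Type*} [Fintype α] [LinearOrder α] {r v : ℕ}
    (hv : v ≤ (Fintype.card α).choose r) :
    ∃ 𝒞 : Finset (Finset α), Colex.IsInitSeg 𝒞 r ∧ #𝒞 = v := by
  induction v with
  | zero => exact ⟨∅, Colex.isInitSeg_empty, rfl⟩
  | succ v ih =>
    obtain ⟨𝒞, h𝒞, hcard⟩ := ih (by omega)
    have hne : (powersetCard r univ \ 𝒞).Nonempty := by
      rw [← card_pos, card_sdiff_of_subset (subset_powersetCard_univ_iff.2 h𝒞.1),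
        card_powersetCard, card_univ]
      omega
    obtain ⟨s, hs, hmin⟩ := exists_min_image _ (fun s : Finset α ↦ toColex s) hne
    simp only [mem_sdiff, mem_powersetCard_univ] at hs hmin
    refine ⟨insert s 𝒞, ⟨fun t ht ↦ ?_, fun t t' ht ⟨hlt, ht'⟩ ↦ ?_⟩,
      by rw [card_insert_of_notMem hs.2, hcard]⟩
    · rcases mem_insert.1 ht with rfl | ht
      exacts [hs.1, h𝒞.1 ht]
    · refine mem_insert_of_mem ?_
      rcases mem_insert.1 ht with rfl | ht
      · by_contra hnot
        exact (hmin t' ⟨ht', hnot⟩).not_gt hlt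
      · exact h𝒞.2 ht ⟨hlt, ht'⟩

lemma UniformCross.card_add_card_shadow_iterate_le {α : Type*} [Fintype α] [DecidableEq α]
    {a b : ℕ} {𝒜 ℬ : Finset (Finset α)} (h : UniformCross a b 𝒜 ℬ)
    (hab : a + b ≤ Fintype.card α) :
    #𝒜 + #(∂^[Fintype.card α - b - a] ℬᶜˢ) ≤ (Fintype.card α).choose a := by
  have hdisj : Disjoint 𝒜 (∂^[Fintype.card α - b - a] ℬᶜˢ) := by
    refine disjoint_left.2 fun A hA hA' ↦ ?_
    obtain ⟨C, hC, hAC, -⟩ := mem_shadow_iterate_iff_exists_sdiff.1 hA'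
    exact h.not_disjoint A hA Cᶜ (mem_compls.1 hC) (disjoint_compl_right.mono_left hAC)
  rw [← card_union_of_disjoint hdisj]
  refine Set.Sized.card_le fun A hA ↦ ?_
  rcases mem_union.1 hA with hA | hA
  · exact h.sized_left hA
  · rw [h.sized_right.compls.shadow_iterate hA]
    omega

lemma uniformCross_sdiff_shadow_iterate {α : Type*} [Fintype α] [DecidableEq α] {a b : ℕ}
    {𝒞 : Finset (Finset α)} (h𝒞 : (𝒞 : Set (Finset α)).Sized (Fintype.card α - b))
    (hab : a + b ≤ Fintype.card α) :
    UniformCross a b (powersetCard a univ \ ∂^[Fintype.card α - b - a] 𝒞) 𝒞ᶜˢ where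
  sized_left A hA := mem_powersetCard_univ.1 (mem_sdiff.1 hA).1
  sized_right := by
    have := h𝒞.compls
    rwa [Nat.sub_sub_self (by omega)] at this
  not_disjoint A hA B hB hAB := by
    obtain ⟨hAa, hA⟩ := mem_sdiff.1 hA
    refine hA (mem_shadow_iterate_iff_exists_mem_card_add.2
      ⟨Bᶜ, mem_compls.1 hB, subset_compl_iff_disjoint_right.2 hAB, ?_⟩)
    rw [h𝒞 (mem_compls.1 hB), mem_powersetCard_univ.1 hAa]
    omega

/- By Kruskal–Katona, replacing the complements of `ℬ` by a colex initial segment does not enlarge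
the set of forbidden members of `𝒜`. -/
lemma UniformCross.exists_isInitSeg {m a b : ℕ} {𝒜 ℬ : Finset (Finset (Fin m))}
    (h : UniformCross a b 𝒜 ℬ) (hab : a + b ≤ m) :
    ∃ 𝒜' ℬ' : Finset (Finset (Fin m)), UniformCross a b 𝒜' ℬ' ∧ #𝒜 ≤ #𝒜' ∧ #ℬ ≤ #ℬ' ∧
      Colex.IsInitSeg ℬ'ᶜˢ (m - b) := by
  have hab' : a + b ≤ Fintype.card (Fin m) := by rwa [Fintype.card_fin]
  have hsized := h.sized_right.compls
  obtain ⟨𝒞, h𝒞, hcard⟩ := exists_isInitSeg_card hsized.card_le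
  have hshadow := iterated_kk (k := Fintype.card (Fin m) - b - a) hsized hcard.le h𝒞
  refine ⟨_, 𝒞ᶜˢ, uniformCross_sdiff_shadow_iterate h𝒞.1 hab', ?_, ?_, ?_⟩
  · have hsplit := h.card_add_card_shadow_iterate_le hab'
    have hsdiff := le_card_sdiff (∂^[Fintype.card (Fin m) - b - a] 𝒞) (powersetCard a univ)
    rw [card_powersetCard, card_univ] at hsdiff
    omega
  · rw [card_compls, hcard, card_compls]
  · simpa only [compls_compls, Fintype.card_fin] using h𝒞

end InitialSegments

section LastPoint

variable {m a b : ℕ} {𝒜 ℬ : Finset (Finset (Fin (m + 1)))} {s : Finset (Fin m)}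

/-- The members of a family that avoid the last point, as a family on the other points. -/
noncomputable def withoutLast (𝒜 : Finset (Finset (Fin (m + 1)))) : Finset (Finset (Fin m)) :=
  pullback Fin.castSuccEmb (𝒜.nonMemberSubfamily (Fin.last m))

/-- The members of a family that contain the last point, with that point removed, as a family on
the other points. -/
noncomputable def withLast (𝒜 : Finset (Finset (Fin (m + 1)))) : Finset (Finset (Fin m)) :=
  pullback Fin.castSuccEmb (𝒜.memberSubfamily (Fin.last m))

lemma last_notMem_map (s : Finset (Fin m)) : Fin.last m ∉ s.map Fin.castSuccEmb := by
  simp [Fin.castSucc_ne_last]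

lemma card_insert_last (s : Finset (Fin m)) :
    #(insert (Fin.last m) (s.map Fin.castSuccEmb)) = #s + 1 := by
  rw [card_insert_of_notMem (last_notMem_map s), card_map]

@[simp]
lemma mem_withoutLast : s ∈ withoutLast 𝒜 ↔ s.map Fin.castSuccEmb ∈ 𝒜 := by
  simp only [withoutLast, mem_pullback, mem_nonMemberSubfamily, last_notMem_map, not_false_eq_true,
    and_true]

@[simp]
lemma mem_withLast : s ∈ withLast 𝒜 ↔ insert (Fin.last m) (s.map Fin.castSuccEmb) ∈ 𝒜 := by
  simp only [withLast, mem_pullback, mem_memberSubfamily, last_notMem_map, not_false_eq_true,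
    and_true]

lemma card_withLast_add_card_withoutLast (𝒜 : Finset (Finset (Fin (m + 1)))) :
    #(withLast 𝒜) + #(withoutLast 𝒜) = #𝒜 := by
  have hrange {A : Finset (Fin (m + 1))} (hA : Fin.last m ∉ A) :
      (A : Set (Fin (m + 1))) ⊆ Set.range Fin.castSuccEmb := fun x hx ↦
    Fin.exists_castSucc_eq.2 fun h ↦ hA (h ▸ hx)
  rw [withLast, withoutLast, card_pullback fun A hA ↦ hrange (mem_memberSubfamily.1 hA).2,
    card_pullback fun A hA ↦ hrange (mem_nonMemberSubfamily.1 hA).2,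
    card_memberSubfamily_add_card_nonMemberSubfamily]

lemma sized_withoutLast (h : (𝒜 : Set (Finset (Fin (m + 1)))).Sized a) :
    (withoutLast 𝒜 : Set (Finset (Fin m))).Sized a := fun _ hs ↦
  (card_map _).symm.trans (h (mem_withoutLast.1 hs))

lemma sized_withLast (h : (𝒜 : Set (Finset (Fin (m + 1)))).Sized (a + 1)) :
    (withLast 𝒜 : Set (Finset (Fin m))).Sized a := fun s hs ↦
  Nat.succ.inj ((card_insert_last s).symm.trans (h (mem_withLast.1 hs)))

lemma UniformCross.symm {α : Type*} {a b : ℕ} {𝒜 ℬ : Finset (Finset α)}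
    (h : UniformCross a b 𝒜 ℬ) : UniformCross b a ℬ 𝒜 where
  sized_left := h.sized_right
  sized_right := h.sized_left
  not_disjoint B hB A hA hBA := h.not_disjoint A hA B hB hBA.symm

lemma UniformCross.withoutLast_withLast (h : UniformCross a (b + 1) 𝒜 ℬ) :
    UniformCross a b (withoutLast 𝒜) (withLast ℬ) where
  sized_left := sized_withoutLast h.sized_left
  sized_right := sized_withLast h.sized_right
  not_disjoint A hA B hB hAB := by
    refine h.not_disjoint _ (mem_withoutLast.1 hA) _ (mem_withLast.1 hB) ?_
    exact disjoint_insert_right.2 ⟨last_notMem_map A, (disjoint_map _).2 hAB⟩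

lemma toColex_lt_of_last {s t : Finset (Fin (m + 1))} (hs : Fin.last m ∈ s)
    (ht : Fin.last m ∉ t) : toColex t < toColex s :=
  Colex.toColex_lt_toColex_iff_exists_forall_lt.2
    ⟨Fin.last m, hs, ht, fun _ hx _ ↦ Fin.lt_last_iff_ne_last.2 fun h ↦ ht (h ▸ hx)⟩

lemma withoutLast_eq_empty_or_withLast_eq (hℬ : (ℬ : Set (Finset (Fin (m + 1)))).Sized (b + 1))
    (hinit : Colex.IsInitSeg ℬᶜˢ (m - b)) :
    withoutLast ℬ = ∅ ∨ withLast ℬ = powersetCard b univ := by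
  refine or_iff_not_imp_left.2 fun hne ↦ ?_
  obtain ⟨s, hs⟩ := nonempty_iff_ne_empty.2 hne
  refine (subset_powersetCard_univ_iff.2 (sized_withLast hℬ)).antisymm fun t ht ↦ ?_
  have hcard : #(insert (Fin.last m) (t.map Fin.castSuccEmb))ᶜ = m - b := by
    rw [card_compl, card_insert_last, mem_powersetCard_univ.1 ht, Fintype.card_fin,
      Nat.add_sub_add_right]
  have hlt : toColex (insert (Fin.last m) (t.map Fin.castSuccEmb))ᶜ <
      toColex (s.map Fin.castSuccEmb)ᶜ :=
    toColex_lt_of_last (mem_compl.2 (last_notMem_map s)) (by simp)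
  have hmem := hinit.2 (compl_mem_compls (mem_withoutLast.1 hs)) ⟨hlt, hcard⟩
  rwa [mem_compls, compl_compl, ← mem_withLast] at hmem

end LastPoint

/-- The sizes `u` and `v` are dominated by those of a cross-intersecting pair of an `a`-uniform and
a `b`-uniform family on `m` points; the slack makes the notion monotone in `u` and `v`. -/
def CrossSizes (m a b u v : ℕ) : Prop :=
  ∃ 𝒜 ℬ : Finset (Finset (Fin m)), UniformCross a b 𝒜 ℬ ∧ u ≤ #𝒜 ∧ v ≤ #ℬ

namespace CrossSizes

variable {m a b l p q c d s M u v : ℕ}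

lemma le_choose_left (h : CrossSizes m a b u v) : u ≤ m.choose a := by
  obtain ⟨𝒜, ℬ, hcross, hu, -⟩ := h
  simpa only [Fintype.card_fin] using hu.trans hcross.sized_left.card_le

lemma le_choose_right (h : CrossSizes m a b u v) : v ≤ m.choose b := by
  obtain ⟨𝒜, ℬ, hcross, -, hv⟩ := h
  simpa only [Fintype.card_fin] using hv.trans hcross.sized_right.card_le

lemma mul_add_mul_le (h : CrossSizes m a b u v) (hab : a + b ≤ m) :
    u * m.choose b + v * m.choose a ≤ m.choose a * m.choose b := by
  obtain ⟨𝒜, ℬ, hcross, hu, hv⟩ := h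
  have hcard := hcross.card_mul_add_card_mul_le (by rwa [Fintype.card_fin])
  rw [Fintype.card_fin] at hcard
  exact (add_le_add (Nat.mul_le_mul_right _ hu) (Nat.mul_le_mul_right _ hv)).trans hcard

lemma eq_zero_of_choose_le (h : CrossSizes m a b u v) (hab : a + b ≤ m) (hv : m.choose b ≤ v) :
    u = 0 := by
  have hb : 0 < m.choose b := Nat.choose_pos (by omega)
  have hline := h.mul_add_mul_le hab
  have hfull : m.choose a * m.choose b ≤ v * m.choose a := by rw [mul_comm]; gcongr
  have hu : u * m.choose b = 0 := by omega
  exact (Nat.mul_eq_zero.1 hu).resolve_right hb.ne'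

lemma eq_zero_of_pos (h : CrossSizes m 0 b u v) (hb : b ≤ m) (hv : 0 < v) : u = 0 := by
  have hline := h.mul_add_mul_le (by omega)
  rw [Nat.choose_zero_right, mul_one, one_mul] at hline
  by_contra hu
  have := Nat.le_mul_of_pos_left (m.choose b) (Nat.pos_of_ne_zero hu)
  omega

lemma exists_withoutLast_eq_empty_or (h : CrossSizes (m + 1) a (b + 1) u v) (hab : a + b ≤ m) :
    ∃ 𝒜 ℬ : Finset (Finset (Fin (m + 1))), UniformCross a (b + 1) 𝒜 ℬ ∧ u ≤ #𝒜 ∧ v ≤ #ℬ ∧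
      (withoutLast ℬ = ∅ ∨ withLast ℬ = powersetCard b univ) := by
  obtain ⟨𝒜₀, ℬ₀, hcross₀, hu, hv⟩ := h
  obtain ⟨𝒜, ℬ, hcross, h𝒜, hℬ, hinit⟩ := hcross₀.exists_isInitSeg (by omega)
  rw [Nat.add_sub_add_right] at hinit
  exact ⟨𝒜, ℬ, hcross, hu.trans h𝒜, hv.trans hℬ,
    withoutLast_eq_empty_or_withLast_eq hcross.sized_right hinit⟩

/- When `ℬ` is no larger than a star it may be taken inside that star, so its size survives the
removal of the last point. -/
lemma of_le_star (h : CrossSizes (m + 1) (a + 1) (b + 1) u v) (hab : a + b + 1 ≤ m)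
    (hv : v ≤ m.choose b) : CrossSizes m (a + 1) b (u - m.choose a) v := by
  obtain ⟨𝒜, ℬ, hcross, hu, hvℬ, hstar⟩ := h.exists_withoutLast_eq_empty_or (by omega)
  refine ⟨_, _, hcross.withoutLast_withLast, ?_, ?_⟩
  · have hsplit := card_withLast_add_card_withoutLast 𝒜
    have hle := (sized_withLast hcross.sized_left).card_le
    rw [Fintype.card_fin] at hle
    omega
  · rcases hstar with hstar | hstar
    · have hsplit := card_withLast_add_card_withoutLast ℬ
      rw [hstar, card_empty] at hsplit
      omega
    · rwa [hstar, card_powersetCard, card_univ, Fintype.card_fin]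

/- When `ℬ` is at least as large as a star it may be taken to contain that star, which forces every
member of `𝒜` through the last point. -/
lemma of_star_le (h : CrossSizes (m + 1) (a + 1) (b + 1) u v) (hab : a + b + 1 ≤ m)
    (hv : m.choose b ≤ v) : CrossSizes m a (b + 1) u (v - m.choose b) := by
  obtain ⟨𝒜, ℬ, hcross, hu, hvℬ, hstar⟩ := h.exists_withoutLast_eq_empty_or (by omega)
  have hsplit𝒜 := card_withLast_add_card_withoutLast 𝒜
  have hsplitℬ := card_withLast_add_card_withoutLast ℬ
  have hle := (sized_withLast hcross.sized_right).card_le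
  rw [Fintype.card_fin] at hle
  have hfull : m.choose b ≤ #(withLast ℬ) := by
    rcases hstar with hstar | hstar
    · rw [hstar, card_empty] at hsplitℬ
      omega
    · rw [hstar, card_powersetCard, card_univ, Fintype.card_fin]
  have hempty : #(withoutLast 𝒜) = 0 :=
    eq_zero_of_choose_le ⟨_, _, hcross.withoutLast_withLast, le_rfl, hfull⟩ (by omega) le_rfl
  exact ⟨_, _, hcross.symm.withoutLast_withLast.symm, by omega, by omega⟩

lemma iterate_of_le_star (h : CrossSizes (l + s) (a + 1) (b + s) u v) (hab : a + b + 1 ≤ l)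
    (hv : v ≤ l.choose b) :
    CrossSizes l (a + 1) b (u - ((l + s).choose (a + 1) - l.choose (a + 1))) v := by
  induction s generalizing u with
  | zero => simpa using h
  | succ s ih =>
    have hpeel := ih (h.of_le_star (m := l + s) (b := b + s) (by omega)
      (hv.trans (choose_le_choose_add_add l b s)))
    have hmono : l.choose (a + 1) ≤ (l + s).choose (a + 1) :=
      Nat.choose_le_choose _ (Nat.le_add_right l s)
    convert hpeel using 1
    rw [← add_assoc, Nat.choose_succ_succ']
    omega

lemma mul_add_le_of_slope (h : CrossSizes l p q (u - c) v) (hpq : p + q ≤ l)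
    (hslope : l.choose q * (c + l.choose p) ≤ l.choose p * M) :
    u * (M + v) ≤ (c + l.choose p) * M :=
  mul_add_le_of_below_segment (Nat.choose_pos (by omega)) hslope (h.mul_add_mul_le hpq)

lemma mul_add_le (h : CrossSizes l c (d + 1) u v) (hcd : c ≤ d) (hl : c + d + 1 ≤ l)
    (hM : l.choose d ≤ M) : u * (M + v) ≤ l.choose c * M := by
  induction c generalizing l M u v with
  | zero =>
    rcases Nat.eq_zero_or_pos v with rfl | hv
    · exact Nat.mul_le_mul_right _ h.le_choose_left
    · simp only [h.eq_zero_of_pos (by omega) hv, zero_mul, zero_le]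
  | succ c ih =>
    obtain ⟨l, rfl⟩ : ∃ l', l = l' + 1 := ⟨l - 1, by omega⟩
    rw [Nat.choose_succ_succ']
    have hslope : l.choose d * (l.choose c + l.choose (c + 1)) ≤ l.choose (c + 1) * M := by
      rw [← Nat.choose_succ_succ']
      exact (choose_mul_succ_choose_le hcd).trans (Nat.mul_le_mul_left _ hM)
    rcases le_total v (l.choose d) with hv | hv
    · exact (h.of_le_star (by omega) hv).mul_add_le_of_slope (by omega) hslope
    · have hrest := ih (M := M + l.choose d) (h.of_star_le (by omega) hv) (by omega) (by omega)
        (Nat.le_add_left _ _)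
      rw [add_assoc, Nat.add_sub_of_le hv] at hrest
      have hcorner : l.choose d * l.choose c ≤ l.choose (c + 1) * M :=
        (Nat.mul_le_mul_left _ (Nat.le_add_right _ _)).trans hslope
      linarith

lemma mul_choose_add_choose_add_le_zero (h : CrossSizes l b (b + 1) (u - (l + 1).choose b) v)
    (hl : 2 * b + 1 ≤ l) :
    u * ((l + 2).choose (b + 1) + l.choose b + v) ≤
      ((l + 1).choose b + l.choose b) * ((l + 2).choose (b + 1) + l.choose b) := by
  have hv := h.le_choose_right
  cases b with
  | zero =>
    have hu := h.le_choose_left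
    simp only [Nat.choose_zero_right, zero_add, Nat.choose_one_right] at h hu hv ⊢
    rcases Nat.eq_zero_or_pos v with rfl | hpos
    · gcongr
      omega
    · have hzero := h.eq_zero_of_pos (by omega) hpos
      calc u * (l + 2 + 1 + v) ≤ 1 * (l + 2 + 1 + l) := by gcongr; omega
        _ ≤ (1 + 1) * (l + 2 + 1) := by omega
  | succ b =>
    obtain ⟨l, rfl⟩ : ∃ l', l = l' + 1 := ⟨l - 1, by omega⟩
    simp only [add_assoc, Nat.reduceAdd] at h hv ⊢
    have hpascal := Nat.choose_succ_succ' l b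
    set M := (l + 3).choose (b + 2) + (l + 1).choose (b + 1) with hM
    rw [← add_assoc _ _ v, ← hM, show (l + 2).choose (b + 1) + (l + 1).choose (b + 1) =
      (l + 2).choose (b + 1) + l.choose b + l.choose (b + 1) by omega]
    rcases le_total v (l.choose (b + 1)) with hsmall | hlarge
    · have hpeel := h.of_le_star (by omega) hsmall
      rw [Nat.sub_sub] at hpeel
      refine hpeel.mul_add_le_of_slope (by omega) (Nat.mul_le_mul_left _ ?_)
      have : (l + 2).choose (b + 1) ≤ (l + 3).choose (b + 2) :=
        choose_le_choose_add_add (l + 2) (b + 1) 1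
      omega
    · have hu' := (h.of_star_le (by omega) hlarge).le_choose_left
      have hcorner := choose_add_choose_mul_choose_le l b
      rw [← hM] at hcorner
      calc u * (M + v)
          ≤ ((l + 2).choose (b + 1) + l.choose b) * (M + (l + 1).choose (b + 2)) := by
            gcongr; omega
        _ ≤ ((l + 2).choose (b + 1) + l.choose b + l.choose (b + 1)) * M := by linarith

lemma mul_choose_add_choose_add_le (h : CrossSizes l (b + s) (b + 1) (u - c) v)
    (hl : 2 * b + s + 1 ≤ l)
    (hc : c + (l + 1).choose (b + s + 1) = (l + s + 2).choose (b + s + 1)) :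
    u * ((l + s + 2).choose (b + s + 1) + l.choose b + v) ≤
      (c + l.choose (b + s)) * ((l + s + 2).choose (b + s + 1) + l.choose b) := by
  cases s with
  | zero =>
    obtain rfl : c = (l + 1).choose b := by
      rw [add_zero, add_zero, Nat.choose_succ_succ' (l + 1) b] at hc
      omega
    exact h.mul_choose_add_choose_add_le_zero hl
  | succ s =>
    refine h.mul_add_le_of_slope (by omega) (Nat.mul_le_mul ?_ ?_)
    · exact choose_le_choose_of_add_le (by omega) (by omega)
    · have := Nat.choose_succ_succ' l (b + (s + 1))
      omega

lemma mul_choose_add_le (h : CrossSizes (l + s + 1) (b + s) (b + s + 1) u v) (hl : 2 * b + s ≤ l)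
    (hv : l.choose b ≤ v) :
    u * ((l + s + 1).choose (b + s) + v) ≤
      ((l + s + 1).choose (b + s) - l.choose (b + s)) *
        ((l + s + 1).choose (b + s) + l.choose b) := by
  induction s generalizing l b with
  | zero =>
    cases b with
    | zero =>
      have hpos := (Nat.choose_pos l.zero_le).trans_le hv
      simp only [h.eq_zero_of_pos (by omega) hpos, zero_mul, zero_le]
    | succ b =>
      have hrest := (h.of_star_le (by omega) hv).mul_add_le
        (M := (l + 1).choose (b + 1) + l.choose (b + 1)) (Nat.le_succ b) (by omega)
        (Nat.le_add_left _ _)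
      rw [add_assoc _ _ (v - _), Nat.add_sub_of_le hv] at hrest
      rwa [add_zero, add_zero, Nat.choose_succ_succ', Nat.add_sub_cancel, ← Nat.choose_succ_succ']
  | succ s ih =>
    have hmono : (l + 1).choose (b + s + 1) ≤ (l + s + 2).choose (b + s + 1) :=
      Nat.choose_le_choose _ (by omega)
    have hpascal := Nat.choose_succ_succ' l (b + s)
    set N := (l + s + 2).choose (b + s + 1) with hN
    set c := N - (l + 1).choose (b + s + 1) with hc
    change u * (N + v) ≤ (N - l.choose (b + s + 1)) * (N + l.choose b)
    rw [show N - l.choose (b + s + 1) = c + l.choose (b + s) by omega]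
    rcases le_total ((l + 1).choose (b + 1)) v with hlarge | hsmall
    · have hprev := ih (l := l + 1) (b := b + 1)
      rw [show l + 1 + s + 1 = l + s + 2 by omega, show b + 1 + s = b + s + 1 by omega, ← hN,
        ← hc, Nat.choose_succ_succ'] at hprev
      -- The extremal products increase with `s`.
      have hcorner := choose_mul_choose_sub_le (l := l) (b := b) (s := s) (by omega)
      rw [← hN, ← hc] at hcorner
      linarith [hprev h (by omega) hlarge]
    · have hpeel := iterate_of_le_star (l := l + 1) (a := b + s) (b := b + 1) (s := s + 1) (u := u)
        (v := v)
      rw [show l + 1 + (s + 1) = l + s + 2 by omega, show b + 1 + (s + 1) = b + s + 2 by omega,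
        ← hN, ← hc] at hpeel
      have hrest := (hpeel h (by omega) hsmall).of_star_le (by omega) hv
      have hbound := hrest.mul_choose_add_choose_add_le (by omega) (Nat.sub_add_cancel hmono)
      rwa [add_assoc, Nat.add_sub_of_le hv] at hbound

end CrossSizes

section Examples

lemma card_filter_subset_disjoint {α : Type*} [DecidableEq α] {S T U : Finset α} {k : ℕ}
    (hS : S ⊆ U) (hT : T ⊆ U) (hST : Disjoint S T) (hk : #S ≤ k) :
    #{B ∈ powersetCard k U | S ⊆ B ∧ Disjoint T B} = (#U - #S - #T).choose (k - #S) := by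
  have hbase : #(U \ (S ∪ T)) = #U - #S - #T := by
    rw [card_sdiff_of_subset (union_subset hS hT), card_union_of_disjoint hST, Nat.sub_sub]
  rw [← hbase, ← card_powersetCard]
  have hdisj {X : Finset α} (hX : X ⊆ U \ (S ∪ T)) : Disjoint S X ∧ Disjoint T X :=
    disjoint_union_left.1 (disjoint_sdiff.mono_right hX)
  refine card_nbij' (· \ S) (S ∪ ·) (fun B hB ↦ ?_) (fun X hX ↦ ?_) (fun B hB ↦ ?_) fun X hX ↦ ?_
  · obtain ⟨hB, hSB, hTB⟩ := mem_filter.1 hB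
    obtain ⟨hBU, hBk⟩ := mem_powersetCard.1 hB
    refine mem_powersetCard.2 ⟨?_, by rw [card_sdiff_of_subset hSB, hBk]⟩
    exact subset_sdiff.2 ⟨sdiff_subset.trans hBU,
      disjoint_union_right.2 ⟨sdiff_disjoint, (hTB.mono_right sdiff_subset).symm⟩⟩
  · obtain ⟨hXU, hXk⟩ := mem_powersetCard.1 hX
    obtain ⟨hSX, hTX⟩ := hdisj hXU
    have hcard : #(S ∪ X) = k := by rw [card_union_of_disjoint hSX, hXk, Nat.add_sub_of_le hk]
    exact mem_filter.2 ⟨mem_powersetCard.2 ⟨union_subset hS (hXU.trans sdiff_subset), hcard⟩,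
      subset_union_left, disjoint_union_right.2 ⟨hST.symm, hTX⟩⟩
  · exact union_sdiff_of_subset (mem_filter.1 hB).2.1
  · exact union_sdiff_cancel_left (hdisj (mem_powersetCard.1 hX).1).1

variable {n k i : ℕ}

lemma card_star (hn : 1 ≤ n) (hk : 1 ≤ k) :
    #{B ∈ kSubsets n k | 1 ∈ B} = (n - 1).choose (k - 1) := by
  have h := card_filter_subset_disjoint (U := Icc 1 n) (singleton_subset_iff.2 (left_mem_Icc.2 hn))
    (empty_subset _) (disjoint_empty_right _) ((card_singleton 1).trans_le hk)
  simpa [kSubsets] using h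

lemma card_exampleA_add (hi : 1 ≤ i) (hin : i ≤ n) (hk : 1 ≤ k) :
    #(exampleA n k i) + (n - i).choose (k - 1) = (n - 1).choose (k - 1) := by
  have hmiss := card_filter_subset_disjoint (S := {1}) (T := Icc 2 i) (U := Icc 1 n)
    (singleton_subset_iff.2 (left_mem_Icc.2 (hi.trans hin))) (Icc_subset_Icc (by omega) hin)
    (by simp) ((card_singleton 1).trans_le hk)
  simp only [card_singleton, Nat.card_Icc, singleton_subset_iff, disjoint_iff_inter_eq_empty]
    at hmiss
  rw [show n + 1 - 1 - 1 - (i + 1 - 2) = n - i by omega] at hmiss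
  rw [← hmiss, ← card_star (hi.trans hin) hk,
    ← card_filter_add_card_filter_not (s := {B ∈ kSubsets n k | 1 ∈ B})
      (fun B ↦ Icc 2 i ∩ B ≠ ∅), filter_filter, filter_filter]
  simp only [exampleA, kSubsets, not_not]

lemma card_exampleB (hi : 2 ≤ i) (hin : i ≤ n) (hik : i ≤ k + 1) :
    #(exampleB n k i) = (n - 1).choose (k - 1) + (n - i).choose (k + 1 - i) := by
  have hrest := card_filter_subset_disjoint (S := Icc 2 i) (T := {1}) (U := Icc 1 n) (k := k)
    (Icc_subset_Icc (by omega) hin) (singleton_subset_iff.2 (left_mem_Icc.2 (by omega)))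
    (by simp) (by rw [Nat.card_Icc]; omega)
  simp only [card_singleton, Nat.card_Icc, disjoint_singleton_left] at hrest
  rw [show n + 1 - 1 - (i + 1 - 2) - 1 = n - i by omega,
    show k - (i + 1 - 2) = k + 1 - i by omega] at hrest
  have hdisj : Disjoint {B ∈ kSubsets n k | 1 ∈ B} {B ∈ kSubsets n k | 1 ∉ B ∧ Icc 2 i ⊆ B} :=
    disjoint_filter.2 fun _ _ hB hB' ↦ hB'.1 hB
  rw [exampleB, card_union_of_disjoint hdisj, card_star (by omega) (by omega), ← hrest]
  simp only [kSubsets, and_comm]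

lemma crossIntersecting_examples : CrossIntersecting (exampleA n k i) (exampleB n k i) := by
  intro A hA B hB
  obtain ⟨-, h1A, hAi⟩ := mem_filter.1 hA
  rw [← nonempty_iff_ne_empty] at hAi ⊢
  rcases mem_union.1 hB with hB | hB
  · exact ⟨1, mem_inter.2 ⟨h1A, (mem_filter.1 hB).2⟩⟩
  · exact hAi.mono fun x hx ↦
      mem_inter.2 ⟨(mem_inter.1 hx).2, (mem_filter.1 hB).2.2 (mem_inter.1 hx).1⟩

end Examples

section UpperBound

variable {n k i : ℕ} {𝒜 ℬ : Finset (Finset ℕ)}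

lemma CrossIntersecting.crossSizes (h : CrossIntersecting 𝒜 ℬ) (h𝒜 : 𝒜 ⊆ kSubsets n k)
    (hℬ : ℬ ⊆ kSubsets n k) : CrossSizes n k k #𝒜 #ℬ := by
  have hcross : UniformCross k k 𝒜 ℬ :=
    ⟨fun A hA ↦ (mem_powersetCard.1 (h𝒜 hA)).2, fun B hB ↦ (mem_powersetCard.1 (hℬ hB)).2,
      fun A hA B hB hAB ↦ h A hA B hB (disjoint_iff_inter_eq_empty.1 hAB)⟩
  let f : Fin n ↪ ℕ := Fin.valEmbedding.trans (addRightEmbedding 1)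
  have hrange {𝒞 : Finset (Finset ℕ)} (h𝒞 : 𝒞 ⊆ kSubsets n k) (C : Finset ℕ) (hC : C ∈ 𝒞) :
      (C : Set ℕ) ⊆ Set.range f := fun x hx ↦ by
    obtain ⟨hx1, hxn⟩ := mem_Icc.1 ((mem_powersetCard.1 (h𝒞 hC)).1 hx)
    exact ⟨⟨x - 1, by omega⟩, Nat.sub_add_cancel hx1⟩
  exact ⟨_, _, hcross.pullback f, (card_pullback (hrange h𝒜)).ge, (card_pullback (hrange hℬ)).ge⟩

lemma CrossIntersecting.card_mul_card_le (h : CrossIntersecting 𝒜 ℬ) (hn : 2 * k ≤ n) (hi : 2 ≤ i)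
    (hik : i ≤ k + 1) (h𝒜 : 𝒜 ⊆ kSubsets n k) (hℬ : ℬ ⊆ kSubsets n k)
    (hcard : #(exampleB n k i) ≤ #ℬ) : #𝒜 * #ℬ ≤ #(exampleA n k i) * #(exampleB n k i) := by
  have hA := card_exampleA_add (n := n) (k := k) (i := i) (by omega) (by omega) (by omega)
  have hB := card_exampleB (n := n) (k := k) hi (by omega) hik
  obtain ⟨s, rfl⟩ := Nat.exists_eq_add_of_le' hi
  obtain ⟨b, rfl⟩ : ∃ b, k = b + s + 1 := ⟨k - (s + 1), by omega⟩
  obtain ⟨l, rfl⟩ : ∃ l, n = l + s + 2 := ⟨n - (s + 2), by omega⟩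
  rw [show l + s + 2 - (s + 2) = l by omega] at hA hB
  rw [show b + s + 1 + 1 - (s + 2) = b by omega] at hB
  simp only [Nat.add_sub_cancel, Nat.add_succ_sub_one] at hA hB
  have hstar := (h.crossSizes h𝒜 hℬ).of_star_le (by omega) (by omega)
  have hbound := hstar.mul_choose_add_le (by omega) (by omega)
  rw [Nat.add_sub_of_le (by omega), ← hB, ← hA, Nat.add_sub_cancel] at hbound
  exact hbound

end UpperBound

end CrossInt

theorem theorem2_general (n k i : ℕ) (hn : 2 * k ≤ n) (hi : 2 ≤ i) (hik : i ≤ k + 1) :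
    (∀ 𝒜 ℬ : Finset (Finset ℕ),
      𝒜 ⊆ CrossInt.kSubsets n k → ℬ ⊆ CrossInt.kSubsets n k →
      CrossInt.CrossIntersecting 𝒜 ℬ →
      (n - 1).choose (k - 1) + (n - i).choose (k + 1 - i) ≤ ℬ.card →
      (𝒜.card : ℤ) * (ℬ.card : ℤ) ≤
        (((n - 1).choose (k - 1) : ℤ) + ((n - i).choose (k + 1 - i) : ℤ)) *
          (((n - 1).choose (k - 1) : ℤ) - ((n - i).choose (k - 1) : ℤ))) ∧
    (CrossInt.exampleA n k i ⊆ CrossInt.kSubsets n k ∧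
      CrossInt.exampleB n k i ⊆ CrossInt.kSubsets n k ∧
      CrossInt.CrossIntersecting (CrossInt.exampleA n k i) (CrossInt.exampleB n k i) ∧
      ((CrossInt.exampleA n k i).card : ℤ) =
        ((n - 1).choose (k - 1) : ℤ) - ((n - i).choose (k - 1) : ℤ) ∧
      ((CrossInt.exampleB n k i).card : ℤ) =
        ((n - 1).choose (k - 1) : ℤ) + ((n - i).choose (k + 1 - i) : ℤ) ∧
      ((CrossInt.exampleA n k i).card : ℤ) * ((CrossInt.exampleB n k i).card : ℤ) =
        (((n - 1).choose (k - 1) : ℤ) + ((n - i).choose (k + 1 - i) : ℤ)) *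
          (((n - 1).choose (k - 1) : ℤ) - ((n - i).choose (k - 1) : ℤ))) := by
  have hA : (#(CrossInt.exampleA n k i) : ℤ) =
      ((n - 1).choose (k - 1) : ℤ) - ((n - i).choose (k - 1) : ℤ) :=
    eq_sub_of_add_eq (mod_cast CrossInt.card_exampleA_add (by omega) (by omega) (by omega))
  have hB := CrossInt.card_exampleB hi (by omega : i ≤ n) hik
  have hB' : (#(CrossInt.exampleB n k i) : ℤ) =
      ((n - 1).choose (k - 1) : ℤ) + ((n - i).choose (k + 1 - i) : ℤ) := mod_cast hB
  refine ⟨fun 𝒜 ℬ h𝒜 hℬ hcross hcard ↦ ?_, filter_subset _ _,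
    union_subset (filter_subset _ _) (filter_subset _ _), CrossInt.crossIntersecting_examples,
    hA, hB', by rw [hA, hB', mul_comm]⟩
  rw [← hA, ← hB', mul_comm (#(CrossInt.exampleB n k i) : ℤ)]
  exact_mod_cast hcross.card_mul_card_le hn hi hik h𝒜 hℬ (hB.trans_le hcard)

theorem theorem2 (n k i : ℕ) (hn : 2 * k ≤ n) (hk : 0 < k) (hi3 : 3 ≤ i) (hik : i ≤ k + 1) :
    (∀ 𝒜 ℬ : Finset (Finset ℕ),
      𝒜 ⊆ CrossInt.kSubsets n k → ℬ ⊆ CrossInt.kSubsets n k →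
      CrossInt.CrossIntersecting 𝒜 ℬ →
      (n - 1).choose (k - 1) + (n - i).choose (k + 1 - i) ≤ ℬ.card →
      (𝒜.card : ℤ) * (ℬ.card : ℤ) ≤
        (((n - 1).choose (k - 1) : ℤ) + ((n - i).choose (k + 1 - i) : ℤ)) *
          (((n - 1).choose (k - 1) : ℤ) - ((n - i).choose (k - 1) : ℤ))) ∧
    (CrossInt.exampleA n k i ⊆ CrossInt.kSubsets n k ∧
      CrossInt.exampleB n k i ⊆ CrossInt.kSubsets n k ∧
      CrossInt.CrossIntersecting (CrossInt.exampleA n k i) (CrossInt.exampleB n k i) ∧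
      ((CrossInt.exampleA n k i).card : ℤ) =
        ((n - 1).choose (k - 1) : ℤ) - ((n - i).choose (k - 1) : ℤ) ∧
      ((CrossInt.exampleB n k i).card : ℤ) =
        ((n - 1).choose (k - 1) : ℤ) + ((n - i).choose (k + 1 - i) : ℤ) ∧
      ((CrossInt.exampleA n k i).card : ℤ) * ((CrossInt.exampleB n k i).card : ℤ) =
        (((n - 1).choose (k - 1) : ℤ) + ((n - i).choose (k + 1 - i) : ℤ)) *
          (((n - 1).choose (k - 1) : ℤ) - ((n - i).choose (k - 1) : ℤ))) := by
  exact theorem2_general n k i hn (by omega) hik
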